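/- **Setting.** Let $M$ be a (Hausdorff) smooth $n$-manifold and $\tau:E\to M$ a smooth real vector bundle of finite rank with a Lie algebroid structure: a smooth vector bundle map $\rho:E\to TM$ over $\mathrm{id}_M$ (the anchor) and a Lie bracket $[\cdot,\cdot]$ on the real vector space of smooth sections of $E$ such that $[\sigma,f\eta]=f[\sigma,\eta]+(\rho(\sigma)f)\,\eta$ for all smooth sections $\sigma,\eta$ and all $f\in C^\infty(M)$. The prolongation $\mathcal{T}^EE\to E$ is the vector bundle with fibres $$\mathcal{T}^E_aE=\{(b,v)\in E_{\tau(a)}\times T_aE:\ \rho(b)=T_a\tau(v)\},\qquad a\in E,$$ and projection $\mathcal{T}\tau(a,b,v)=b$. It is a Lie algebroid over $E$ with anchor $\rho^1(a,b,v)=v$ and with the bracket that is given on projectable sections $Z_i(a)=(a,\sigma_i(\tau(a)),X_i(a))$ (with $\sigma_i$ a section of $E$ and $X_i$ a vector field on $E$) by $[Z_1,Z_2](a)=(a,[\sigma_1,\sigma_2](\tau(a)),[X_1,X_2](a))$. Let $d$ be its differential: $df(Z)=\rho^1(Z)f$ for functions $f$ on $E$, and $d\theta(Z,W)=\rho^1(Z)(\theta(W))-\rho^1(W)(\theta(Z))-\theta([Z,W])$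 for one-forms $\theta$. For $b\in E_{\tau(a)}$ let $b^{\mathsf v}_a\in T_aE$ be the velocity at $t=0$ of $t\mapsto a+tb$. Put $S(a,b,v)=(a,0,b^{\mathsf v}_a)$ (vertical endomorphism) and $\Delta(a)=(a,0,a^{\mathsf v}_a)$ (Liouville section). Let $L:E\to\mathbb R$ be a smooth function and $D\subseteq E$ a smooth vector subbundle over $M$; the pair $(L,D)$ is a linearly constrained Lagrangian system. Put $\theta_L=S^*(dL)$, $\omega_L=-d\theta_L$ and $E_L=d_\Delta L-L$, where $d_Zf=\langle df,Z\rangle$. Let $D^\circ\subseteq E^*$ be the annihilator of $D$. For $a\in D$ let $\widetilde{D^\circ}_a=\{\lambda\circ\mathcal{T}\tau|_{\mathcal{T}^E_aE}:\lambda\in D^\circ_{\tau(a)}\}$ and $\mathcal{T}^D_aD=\{(b,v)\in\mathcal{T}^E_aE:\ b\in D_{\tau(a)},\ v\in T_aD\}$. A *solution* of $(L,D)$ is a section $\Gamma$ of $\mathcal{T}^EE$, given and smooth along $D$ (its values off $D$, if any, play no role), that satisfies $S\Gamma=\Delta$ on $D$ (it is a second-order section) and the Lagrange–d'Alembert equations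 $$(i_\Gamma\omega_L-dE_L)_a\in\widetilde{D^\circ}_a,\qquad \Gamma(a)\in\mathcal{T}^D_aD\qquad\text{for every }a\in D.$$ **Theorem (Conservation of energy).** If $\Gamma$ is a solution of a linearly constrained Lagrangian system $(L,D)$ on a Lie algebroid $E$, then $d_\Gamma E_L=0$ on $D$; that is, $\langle dE_L,\Gamma\rangle(a)=0$ for every $a\in D$. -/

import Mathlib

open Bundle
open scoped Manifold ContDiff Topology

set_option linter.unusedSectionVars false

section Auxiliary

variable {H : Type*} [TopologicalSpace H] {B : Type*} [NormedAddCommGroup B] [NormedSpace ℝ B]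
  {J : ModelWithCorners ℝ B H}
  {N : Type*} [TopologicalSpace N] [ChartedSpace H N] [IsManifold J ∞ N]

theorem exists_bump [FiniteDimensional ℝ B] [T2Space N] (p : N) {U : Set N} (hU : U ∈ 𝓝 p) :
    ∃ ψ : N → ℝ, ContMDiff J 𝓘(ℝ, ℝ) ∞ ψ ∧ tsupport ψ ⊆ U ∧ ψ =ᶠ[𝓝 p] 1 := by
  obtain ⟨ψ, -, h⟩ := (SmoothBumpFunction.nhds_basis_tsupport (I := J) p).mem_iff.mp hU
  exact ⟨ψ, ψ.contMDiff, h, ψ.eventuallyEq_one⟩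

theorem tangent_ext [T2Space N] [FiniteDimensional ℝ B]  [J.Boundaryless] {p : N} {v w : TangentSpace J p}
    (h : ∀ f : N → ℝ, ContMDiff J 𝓘(ℝ, ℝ) ∞ f → mvfderiv J f p v = mvfderiv J f p w) : v = w := by
  obtain ⟨ψ⟩ : Nonempty (SmoothBumpFunction J p) := inferInstance
  have hG : ContMDiff J 𝓘(ℝ, B) ∞ (fun x => ψ x • extChartAt J p x) :=
    ψ.contMDiff_smul (contMDiffOn_extChartAt (x := p))
  have hev : (fun x => ψ x • extChartAt J p x) =ᶠ[𝓝 p] extChartAt J p := by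
    filter_upwards [ψ.eventuallyEq_one] with x hx
    simp [hx]
  have hinj : Function.Injective (mfderiv J 𝓘(ℝ, B) (extChartAt J p) p) :=
    (isInvertible_mfderiv_extChartAt (mem_extChartAt_source (I := J) p)).injective
  apply hinj
  rw [← hev.mfderiv_eq]
  refine (SeparatingDual.eq_iff_forall_dual_eq (R := ℝ) (V := B)).mpr fun c => ?_
  have hc : ∀ u : TangentSpace J p, mvfderiv J (fun x => c (ψ x • extChartAt J p x)) p u =
      c (mfderiv J 𝓘(ℝ, B) (fun x => ψ x • extChartAt J p x) p u) := by
    intro u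
    have h1 : HasMFDerivAt 𝓘(ℝ, B) 𝓘(ℝ, ℝ) c (ψ p • extChartAt J p p) c :=
      c.hasMFDerivAt
    have h2 := (hG.mdifferentiable (by simp) p).hasMFDerivAt
    have h3 := h1.comp p h2
    exact congrArg (fun l => l u) h3.mfderiv
  have := h (fun x => c (ψ x • extChartAt J p x)) (c.contMDiff.comp hG)
  rw [hc, hc] at this
  exact this

theorem contMDiff_mvfderiv {f : N → ℝ} {X : ∀ q : N, TangentSpace J q}
    (hf : ContMDiff J 𝓘(ℝ, ℝ) ∞ f)
    (hX : ContMDiff J J.tangent ∞ (fun q => (⟨q, X q⟩ : TangentBundle J N))) :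
    ContMDiff J 𝓘(ℝ, ℝ) ∞ (fun q => mvfderiv J f q (X q)) := by
  have h := (hf.contMDiff_tangentMap (m := ∞) (by simp)).comp hX
  have h2 := (contMDiff_snd_tangentBundle_modelSpace ℝ 𝓘(ℝ, ℝ) (n := ∞)).comp h
  exact h2

theorem mvfderiv_mlieBracket [FiniteDimensional ℝ B] {p : N} {f : N → ℝ} {X Y : ∀ q : N, TangentSpace J q}
    (hf : ContMDiff J 𝓘(ℝ, ℝ) ∞ f)
    (hX : ContMDiff J J.tangent ∞ (fun q => (⟨q, X q⟩ : TangentBundle J N)))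
    (hY : ContMDiff J J.tangent ∞ (fun q => (⟨q, Y q⟩ : TangentBundle J N))) :
    mvfderiv J f p (VectorField.mlieBracket J X Y p) =
      mvfderiv J (fun q => mvfderiv J f q (Y q)) p (X p) -
      mvfderiv J (fun q => mvfderiv J f q (X q)) p (Y p) := by
  by_cases hB : Subsingleton B
  · have h0 : ∀ v : TangentSpace J p, v = 0 := fun v => Subsingleton.elim (α := B) v 0
    rw [h0 (VectorField.mlieBracket J X Y p), h0 (X p), h0 (Y p)]
    simp
  rw [not_subsingleton_iff_nontrivial] at hB
  obtain ⟨z, hz⟩ := exists_ne (0 : B)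
  let Z : ∀ q : N, TangentSpace J q := FiberBundle.extend B (x := p) z
  have hZp : Z p = z := FiberBundle.extend_apply_self ..
  have hZ : ∀ᶠ q in 𝓝 p, ContMDiffAt J J.tangent ∞
      (fun q => (⟨q, Z q⟩ : TangentBundle J N)) q := by
    obtain ⟨s, hs, hs'⟩ := FiberBundle.exists_contMDiffOn_extend J B (V := TangentSpace J) (k := ∞) (x₀ := p) z
    filter_upwards [eventually_mem_nhds_iff.mpr hs] with q hq
    exact hs'.contMDiffAt hq
  have two : minSmoothness ℝ 2 ≤ ∞ := by
    rw [minSmoothness_of_isRCLikeNormedField]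
    exact ENat.LEInfty.out
  have : IsManifold J (minSmoothness ℝ 3) N := by
    rw [minSmoothness_of_isRCLikeNormedField]
    exact IsManifold.of_le (n := ∞) (ENat.LEInfty.out)
  have hfY := contMDiff_mvfderiv hf hY
  have hfX := contMDiff_mvfderiv hf hX
  have hfZ : ContMDiffAt J J.tangent ∞ (fun q => (⟨q, (f • Z) q⟩ : TangentBundle J N)) p :=
    (hf p).smul_section hZ.self_of_nhds
  have key := VectorField.leibniz_identity_mlieBracket_apply ((hX p).of_le two) ((hY p).of_le two)
    (hfZ.of_le two)
  have md : ∀ g : N → ℝ, ContMDiff J 𝓘(ℝ, ℝ) ∞ g → ∀ q, MDifferentiableAt J 𝓘(ℝ, ℝ) g q :=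
    fun g hg => hg.mdifferentiable (by simp)
  have mdZ : ∀ᶠ q in 𝓝 p, MDifferentiableAt J J.tangent
      (fun q => (⟨q, Z q⟩ : TangentBundle J N)) q :=
    hZ.mono fun q h => h.mdifferentiableAt (by simp)
  have br : ∀ W : ∀ q : N, TangentSpace J q,
      VectorField.mlieBracket J W (f • Z) =ᶠ[𝓝 p]
        (fun q => mvfderiv J f q (W q)) • Z + f • VectorField.mlieBracket J W Z := by
    intro W
    filter_upwards [mdZ] with q hq
    exact VectorField.mlieBracket_smul_right (md f hf q) hq
  have mdbr : ∀ W : ∀ q : N, TangentSpace J q,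
      ContMDiff J J.tangent ∞ (fun q => (⟨q, W q⟩ : TangentBundle J N)) →
      MDifferentiableAt J J.tangent
        (fun q => (⟨q, VectorField.mlieBracket J W Z q⟩ : TangentBundle J N)) p := by
    intro W hW
    have : IsManifold J (((⊤ : ℕ∞) : WithTop ℕ∞) + 1) N := by simpa
    have := ContMDiffAt.mlieBracket_vectorField (m := 1) (n := ⊤) (hW p) hZ.self_of_nhds
      (by rw [minSmoothness_of_isRCLikeNormedField]; exact mod_cast le_top)
    exact this.mdifferentiableAt (by simp)
  have dbl : ∀ U W : ∀ q : N, TangentSpace J q,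
      ContMDiff J J.tangent ∞ (fun q => (⟨q, W q⟩ : TangentBundle J N)) →
      VectorField.mlieBracket J U (VectorField.mlieBracket J W (f • Z)) p =
        (mvfderiv J (fun q => mvfderiv J f q (W q)) p (U p) • Z p +
          mvfderiv J f p (W p) • VectorField.mlieBracket J U Z p) +
        (mvfderiv J f p (U p) • VectorField.mlieBracket J W Z p +
          f p • VectorField.mlieBracket J U (VectorField.mlieBracket J W Z) p) := by
    intro U W hW
    have hb := Filter.EventuallyEq.mlieBracket_vectorField_eq (I := J)
      (Filter.EventuallyEq.refl (𝓝 p) U) (br W)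
    rw [hb]
    have hfW := md _ (contMDiff_mvfderiv hf hW) p
    have h1 := hfW.smul_section mdZ.self_of_nhds
    have h2 := (md f hf p).smul_section (mdbr W hW)
    rw [VectorField.mlieBracket_add_right h1 h2,
      VectorField.mlieBracket_smul_right hfW mdZ.self_of_nhds,
      VectorField.mlieBracket_smul_right (md f hf p) (mdbr W hW)]
  have jac := VectorField.leibniz_identity_mlieBracket_apply ((hX p).of_le two) ((hY p).of_le two)
    (hZ.self_of_nhds.of_le two)
  rw [dbl X Y hY, dbl Y X hX,
    VectorField.mlieBracket_smul_right (md f hf p) mdZ.self_of_nhds, jac] at key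
  rw [← sub_eq_zero]
  have : (mvfderiv J f p (VectorField.mlieBracket J X Y p) -
      (mvfderiv J (fun q => mvfderiv J f q (Y q)) p (X p) -
      mvfderiv J (fun q => mvfderiv J f q (X q)) p (Y p))) • Z p = 0 := by
    rw [sub_smul, sub_smul]
    have := sub_eq_zero.mpr key
    rw [← neg_eq_zero, ← this]
    module
  rw [hZp] at this
  exact (smul_eq_zero.mp this).resolve_right hz


end Auxiliary

section Algebroid

variable (n : ℕ) {M : Type*} [TopologicalSpace M] [ChartedSpace (EuclideanSpace ℝ (Fin n)) M]
  [IsManifold (𝓡 n) ∞ M]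
  (F : Type*) [NormedAddCommGroup F] [NormedSpace ℝ F]
  (V : M → Type*) [TopologicalSpace (TotalSpace F V)]
  [∀ x, AddCommGroup (V x)] [∀ x, Module ℝ (V x)] [∀ x, TopologicalSpace (V x)]
  [FiberBundle F V] [VectorBundle ℝ F V]

variable {n F V} in
/-- The product of a smooth function and a smooth section. -/
noncomputable def smulSection (f : C^∞⟮𝓡 n, M; 𝓘(ℝ, ℝ), ℝ⟯) (σ : Cₛ^∞⟮𝓡 n; F, V⟯) :
    Cₛ^∞⟮𝓡 n; F, V⟯ :=
  ⟨fun x => f x • σ x, f.contMDiff.smul_section σ.contMDiff⟩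

/-- A Lie algebroid structure on a smooth vector bundle `V → M`. -/
structure LieAlgebroid where
  /-- the anchor, a vector bundle map over the identity of `M` -/
  anchor : ∀ x : M, V x →ₗ[ℝ] TangentSpace (𝓡 n) x
  contMDiff_anchor : ContMDiff ((𝓡 n).prod 𝓘(ℝ, F)) (𝓡 n).tangent ∞
    (fun a : TotalSpace F V => (⟨a.1, anchor a.1 a.2⟩ : TangentBundle (𝓡 n) M))
  /-- the bracket of smooth sections -/
  bracket : Cₛ^∞⟮𝓡 n; F, V⟯ →ₗ[ℝ] Cₛ^∞⟮𝓡 n; F, V⟯ →ₗ[ℝ] Cₛ^∞⟮𝓡 n; F, V⟯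
  bracket_self : ∀ σ, bracket σ σ = 0
  jacobi : ∀ σ η ζ, bracket σ (bracket η ζ) = bracket (bracket σ η) ζ + bracket η (bracket σ ζ)
  leibniz : ∀ (f : C^∞⟮𝓡 n, M; 𝓘(ℝ, ℝ), ℝ⟯) (σ η : Cₛ^∞⟮𝓡 n; F, V⟯) (x : M),
    bracket σ (smulSection f η) x =
      f x • bracket σ η x + mvfderiv (𝓡 n) f x (anchor x (σ x)) • η x

variable {n F V} [ContMDiffVectorBundle ∞ F V (𝓡 n)]

theorem exists_section [T2Space M] {x : M} (b : V x) : ∃ ψ : M → ℝ, ∃ U : Set M, IsOpen U ∧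
    tsupport ψ ⊆ U ∧ U ⊆ (trivializationAt F V x).baseSet ∧
    ContMDiff (𝓡 n) 𝓘(ℝ, ℝ) ∞ ψ ∧ ψ x = 1 ∧
    ContMDiffOn (𝓡 n) ((𝓡 n).prod 𝓘(ℝ, F)) ∞
      (fun y => (⟨y, FiberBundle.extend F b y⟩ : TotalSpace F V)) U ∧
    ∃ σ : Cₛ^∞⟮𝓡 n; F, V⟯, σ x = b ∧ ∀ y, σ y = ψ y • FiberBundle.extend F b y := by
  obtain ⟨s, hs, hs'⟩ := FiberBundle.exists_contMDiffOn_extend (𝓡 n) F (V := V) (k := ∞) b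
  obtain ⟨U, hUs, hU, hxU⟩ := mem_nhds_iff.mp (Filter.inter_mem hs
    ((trivializationAt F V x).open_baseSet.mem_nhds
      (FiberBundle.mem_baseSet_trivializationAt F V x)))
  obtain ⟨ψ, h1, h2, h3⟩ := exists_bump (J := 𝓡 n) x (hU.mem_nhds hxU)
  have hψ : ψ x = 1 := h3.self_of_nhds
  have hE := hs'.mono (hUs.trans Set.inter_subset_left)
  refine ⟨ψ, U, hU, h2, hUs.trans Set.inter_subset_right, h1, hψ, hE,
    ⟨fun y => ψ y • FiberBundle.extend F b y,
      ContMDiffOn.smul_section_of_tsupport h1.contMDiffOn hU h2 hE⟩, ?_, fun y => rfl⟩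
  simp [hψ]

namespace LieAlgebroid

variable (A : LieAlgebroid n F V)

/-- The vector field `ρ(σ)` on `M`. -/
noncomputable def anchorField (σ : Cₛ^∞⟮𝓡 n; F, V⟯) (x : M) : TangentSpace (𝓡 n) x :=
  A.anchor x (σ x)

theorem contMDiff_anchorField (σ : Cₛ^∞⟮𝓡 n; F, V⟯) : ContMDiff (𝓡 n) (𝓡 n).tangent ∞
    (fun x => (⟨x, A.anchorField σ x⟩ : TangentBundle (𝓡 n) M)) :=
  A.contMDiff_anchor.comp σ.contMDiff

/-- The anchor is a homomorphism: `ρ[σ, η] f = ρ(σ)(ρ(η) f) - ρ(η)(ρ(σ) f)`. -/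
theorem anchor_bracket [T2Space M] (σ η : Cₛ^∞⟮𝓡 n; F, V⟯) {f : M → ℝ} (hf : ContMDiff (𝓡 n) 𝓘(ℝ, ℝ) ∞ f)
    (x : M) :
    mvfderiv (𝓡 n) f x (A.anchorField (A.bracket σ η) x) =
      mvfderiv (𝓡 n) (fun y => mvfderiv (𝓡 n) f y (A.anchorField η y)) x (A.anchorField σ x) -
      mvfderiv (𝓡 n) (fun y => mvfderiv (𝓡 n) f y (A.anchorField σ y)) x (A.anchorField η x) := by
  by_cases hV : ∀ b : V x, b = 0
  · simp only [anchorField]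
    rw [hV (A.bracket σ η x), hV (σ x), hV (η x)]
    simp
  push Not at hV
  obtain ⟨b, hb⟩ := hV
  obtain ⟨-, -, -, -, -, -, -, -, ζ, hζ, -⟩ := exists_section (n := n) (F := F) b
  have hd : ∀ σ : Cₛ^∞⟮𝓡 n; F, V⟯, ContMDiff (𝓡 n) 𝓘(ℝ, ℝ) ∞
      (fun y => mvfderiv (𝓡 n) f y (A.anchorField σ y)) :=
    fun σ => contMDiff_mvfderiv hf (A.contMDiff_anchorField σ)
  let g : C^∞⟮𝓡 n, M; 𝓘(ℝ, ℝ), ℝ⟯ := ⟨f, hf⟩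
  let D : Cₛ^∞⟮𝓡 n; F, V⟯ → C^∞⟮𝓡 n, M; 𝓘(ℝ, ℝ), ℝ⟯ := fun σ => ⟨_, hd σ⟩
  have lb : ∀ (σ ζ : Cₛ^∞⟮𝓡 n; F, V⟯), A.bracket σ (smulSection g ζ) =
      smulSection g (A.bracket σ ζ) + smulSection (D σ) ζ := by
    intro σ ζ
    ext y
    exact A.leibniz g σ ζ y
  have dbl : ∀ σ η, A.bracket σ (A.bracket η (smulSection g ζ)) x =
      (g x • A.bracket σ (A.bracket η ζ) x + D σ x • A.bracket η ζ x) +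
      (D η x • A.bracket σ ζ x + mvfderiv (𝓡 n) (D η) x (A.anchor x (σ x)) • ζ x) := by
    intro σ η
    rw [lb, map_add, ContMDiffSection.coe_add, Pi.add_apply, A.leibniz, A.leibniz]
    rfl
  have key := congrArg (fun s => s x) (A.jacobi σ η (smulSection g ζ))
  have jac := congrArg (fun s => s x) (A.jacobi σ η ζ)
  simp only [ContMDiffSection.coe_add, Pi.add_apply] at key jac
  rw [dbl, dbl, A.leibniz, jac] at key
  rw [← sub_eq_zero]
  have : (mvfderiv (𝓡 n) f x (A.anchorField (A.bracket σ η) x) -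
      (mvfderiv (𝓡 n) (fun y => mvfderiv (𝓡 n) f y (A.anchorField η y)) x (A.anchorField σ x) -
      mvfderiv (𝓡 n) (fun y => mvfderiv (𝓡 n) f y (A.anchorField σ y)) x (A.anchorField η x)))
        • ζ x = 0 := by
    change (mvfderiv (𝓡 n) g x (A.anchor x (A.bracket σ η x)) -
      (mvfderiv (𝓡 n) (D η) x (A.anchor x (σ x)) - mvfderiv (𝓡 n) (D σ) x (A.anchor x (η x))))
        • ζ x = 0
    rw [sub_smul, sub_smul]
    have := sub_eq_zero.mpr key
    rw [← neg_eq_zero, ← this]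
    module
  rw [hζ] at this
  exact (smul_eq_zero.mp this).resolve_right hb


/-- The fibre at `a` of the prolongation `𝒯ᴱE`: the pairs `(b, v)` with `b` in the fibre of `E`
through `a`, `v` tangent to `E` at `a` and `ρ(b) = Tτ(v)`. -/
noncomputable def prolongation (a : TotalSpace F V) :
    Submodule ℝ (V a.1 × TangentSpace ((𝓡 n).prod 𝓘(ℝ, F)) a) where
  carrier := {z | A.anchor a.1 z.1 =
    mfderiv ((𝓡 n).prod 𝓘(ℝ, F)) (𝓡 n) (TotalSpace.proj : TotalSpace F V → M) a z.2}
  add_mem' := by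
    intro z w hz hw
    simp only [Set.mem_ofPred_eq, Prod.fst_add, Prod.snd_add, map_add] at *
    rw [hz, hw]
  zero_mem' := by simp
  smul_mem' := by
    intro c z hz
    simp only [Set.mem_ofPred_eq, Prod.smul_fst, Prod.smul_snd, map_smul] at *
    rw [hz]

/-- The projection `𝒯τ : (a, b, v) ↦ b`. -/
noncomputable def prolProj (a : TotalSpace F V) : A.prolongation a →ₗ[ℝ] V a.1 :=
  LinearMap.fst ℝ _ _ ∘ₗ (A.prolongation a).subtype

/-- The anchor `ρ¹ : (a, b, v) ↦ v` of the prolongation. -/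
noncomputable def prolAnchor (a : TotalSpace F V) :
    A.prolongation a →ₗ[ℝ] TangentSpace ((𝓡 n).prod 𝓘(ℝ, F)) a :=
  LinearMap.snd ℝ _ _ ∘ₗ (A.prolongation a).subtype

end LieAlgebroid

theorem contMDiff_trivialization_symm (x : M) : ContMDiff 𝓘(ℝ, F) ((𝓡 n).prod 𝓘(ℝ, F)) ∞
    (fun w : F => (⟨x, (trivializationAt F V x).symm x w⟩ : TotalSpace F V)) := by
  have hx : x ∈ (trivializationAt F V x).baseSet := FiberBundle.mem_baseSet_trivializationAt F V x
  have h1 := (trivializationAt F V x).contMDiffOn_symm (IB := 𝓡 n) (n := ∞)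
  have h2 : ContMDiff 𝓘(ℝ, F) ((𝓡 n).prod 𝓘(ℝ, F)) ∞ (fun w : F => (x, w)) :=
    contMDiff_const.prodMk contMDiff_id
  have h3 := h1.comp_contMDiff h2
    (fun w => (trivializationAt F V x).mem_target.mpr hx)
  refine h3.congr fun w => ?_
  exact (trivializationAt F V x).mk_symm hx w

/-- The lines `t ↦ a + t b` are differentiable, with velocity depending linearly on `b`. -/
theorem hasMFDerivAt_line (a : TotalSpace F V) :
    ∃ T : V a.1 →ₗ[ℝ] TangentSpace ((𝓡 n).prod 𝓘(ℝ, F)) a, ∀ b : V a.1,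
      MDifferentiableAt 𝓘(ℝ, ℝ) ((𝓡 n).prod 𝓘(ℝ, F))
        (fun t : ℝ => (⟨a.1, a.2 + t • b⟩ : TotalSpace F V)) 0 ∧
      (mfderiv 𝓘(ℝ, ℝ) ((𝓡 n).prod 𝓘(ℝ, F))
        (fun t : ℝ => (⟨a.1, a.2 + t • b⟩ : TotalSpace F V)) 0 (1 : ℝ)) = T b := by
  have hx : a.1 ∈ (trivializationAt F V a.1).baseSet :=
    FiberBundle.mem_baseSet_trivializationAt F V a.1
  have hcm := contMDiff_trivialization_symm (n := n) (F := F) (V := V) a.1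
  have hl : ∀ c : V a.1, (trivializationAt F V a.1).symm a.1
      ((trivializationAt F V a.1).linearMapAt ℝ a.1 c) = c :=
    fun c => by
      rw [← Trivialization.symmₗ_apply (R := ℝ) (trivializationAt F V a.1) hx]
      exact (trivializationAt F V a.1).symmₗ_linearMapAt (R := ℝ) hx c
  generalize (trivializationAt F V a.1).linearMapAt ℝ a.1 = l at hl
  generalize (trivializationAt F V a.1).symm a.1 = s at hl hcm
  let g : F → TotalSpace F V := fun w => ⟨a.1, s w⟩
  have hg : MDifferentiable 𝓘(ℝ, F) ((𝓡 n).prod 𝓘(ℝ, F)) g := hcm.mdifferentiable (by simp)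
  let T' : F → (F →L[ℝ] EuclideanSpace ℝ (Fin n) × F) := fun w =>
    mfderiv 𝓘(ℝ, F) ((𝓡 n).prod 𝓘(ℝ, F)) g w
  refine ⟨(T' (l a.2)).toLinearMap ∘ₗ l, fun b => ?_⟩
  have hcurve : (fun t : ℝ => (⟨a.1, a.2 + t • b⟩ : TotalSpace F V)) =
      g ∘ (fun t : ℝ => l a.2 + t • l b) := by
    funext t
    simp only [Function.comp_apply, g]
    rw [← map_smul, ← map_add, hl]
  have h0 : l a.2 + (0 : ℝ) • l b = l a.2 := by simp
  have hd : HasFDerivAt (fun t : ℝ => l a.2 + t • l b)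
      ((ContinuousLinearMap.id ℝ ℝ).smulRight (l b)) 0 :=
    ((hasFDerivAt_id (𝕜 := ℝ) (0 : ℝ)).smul_const (l b)).const_add (l a.2)
  have hc := HasMFDerivAt.comp (0 : ℝ) (hg (l a.2 + (0 : ℝ) • l b)).hasMFDerivAt hd.hasMFDerivAt
  rw [hcurve]
  refine ⟨hc.mdifferentiableAt, ?_⟩
  refine (congrArg (fun m => m (1 : ℝ)) hc.mfderiv).trans ?_
  change T' (l a.2 + (0 : ℝ) • l b) ((1 : ℝ) • l b) = T' (l a.2) (l b)
  rw [one_smul, h0]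

theorem mfderiv_proj_line (a : TotalSpace F V) (b : V a.1) :
    mfderiv ((𝓡 n).prod 𝓘(ℝ, F)) (𝓡 n) (TotalSpace.proj : TotalSpace F V → M) a
      (mfderiv 𝓘(ℝ, ℝ) ((𝓡 n).prod 𝓘(ℝ, F))
        (fun t : ℝ => (⟨a.1, a.2 + t • b⟩ : TotalSpace F V)) 0 (1 : ℝ)) = 0 := by
  obtain ⟨T, hT⟩ := hasMFDerivAt_line (n := n) a
  have h1 := (contMDiff_proj (E := V) (F := F) (IB := 𝓡 n) (n := ∞)).mdifferentiable
    (by simp)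
  let T' : TotalSpace F V → (EuclideanSpace ℝ (Fin n) × F →L[ℝ] EuclideanSpace ℝ (Fin n)) :=
    fun a => mfderiv ((𝓡 n).prod 𝓘(ℝ, F)) (𝓡 n) (TotalSpace.proj : TotalSpace F V → M) a
  have h0 : (⟨a.1, a.2 + (0 : ℝ) • b⟩ : TotalSpace F V) = a := by simp
  have h2 := HasMFDerivAt.comp (0 : ℝ) (h1 _).hasMFDerivAt (hT b).1.hasMFDerivAt
  have h3 : HasMFDerivAt 𝓘(ℝ, ℝ) (𝓡 n) (TotalSpace.proj ∘
      (fun t : ℝ => (⟨a.1, a.2 + t • b⟩ : TotalSpace F V))) 0 0 := hasMFDerivAt_const a.1 0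
  refine Eq.trans ?_ (congrArg (fun m => m (1 : ℝ)) (hasMFDerivAt_unique h2 h3))
  change T' a _ = T' ⟨a.1, a.2 + (0 : ℝ) • b⟩ _
  rw [h0]
  rfl

/-- The vector `bᵛ` tangent at `a` to the curve `t ↦ a + t b` at `t = 0`, as a linear function
of `b`. -/
noncomputable def verticalVector (a : TotalSpace F V) :
    V a.1 →ₗ[ℝ] TangentSpace ((𝓡 n).prod 𝓘(ℝ, F)) a where
  toFun b := mfderiv 𝓘(ℝ, ℝ) ((𝓡 n).prod 𝓘(ℝ, F))
    (fun t : ℝ => (⟨a.1, a.2 + t • b⟩ : TotalSpace F V)) 0 (1 : ℝ)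
  map_add' b c := by
    obtain ⟨T, hT⟩ := hasMFDerivAt_line (n := n) a
    exact (hT _).2.trans ((T.map_add b c).trans (congrArg₂ _ (hT b).2.symm (hT c).2.symm))
  map_smul' r b := by
    obtain ⟨T, hT⟩ := hasMFDerivAt_line (n := n) a
    exact (hT _).2.trans ((T.map_smul r b).trans (congrArg _ (hT b).2.symm))

namespace LieAlgebroid

variable (A : LieAlgebroid n F V)

/-- The vertical lift `ξⱽ(a, b) = (a, 0, bᵛ)`. -/
noncomputable def verticalLift (a : TotalSpace F V) : V a.1 →ₗ[ℝ] A.prolongation a :=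
  ((0 : V a.1 →ₗ[ℝ] V a.1).prod (verticalVector a)).codRestrict (A.prolongation a) fun b =>
    ((A.anchor a.1).map_zero).trans (mfderiv_proj_line a b).symm

/-- The vertical endomorphism `S(a, b, v) = ξⱽ(a, b)`. -/
noncomputable def verticalEndo (a : TotalSpace F V) : A.prolongation a →ₗ[ℝ] A.prolongation a :=
  A.verticalLift a ∘ₗ A.prolProj a

/-- The Liouville section `Δ(a) = ξⱽ(a, a)`. -/
noncomputable def liouville (a : TotalSpace F V) : A.prolongation a :=
  A.verticalLift a a.2

/-- The differential `df` (in the Lie algebroid `𝒯ᴱE`) of a function on `E`. -/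
noncomputable def dFun (f : TotalSpace F V → ℝ) (a : TotalSpace F V) : A.prolongation a →ₗ[ℝ] ℝ :=
  (mvfderiv ((𝓡 n).prod 𝓘(ℝ, F)) f a).toLinearMap ∘ₗ A.prolAnchor a

/-- The derivative `d_Z f = ⟨df, Z⟩` of a function on `E` along a section `Z` of `𝒯ᴱE`. -/
noncomputable def lieDeriv (Z : ∀ a : TotalSpace F V, A.prolongation a) (f : TotalSpace F V → ℝ)
    (a : TotalSpace F V) : ℝ :=
  A.dFun f a (Z a)

/-- The Cartan one-form `θ_L = S^*(dL)`. -/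
noncomputable def cartanOneForm (L : TotalSpace F V → ℝ) (a : TotalSpace F V) :
    A.prolongation a →ₗ[ℝ] ℝ :=
  A.dFun L a ∘ₗ A.verticalEndo a

/-- The energy `E_L = d_Δ L - L`. -/
noncomputable def energy (L : TotalSpace F V → ℝ) (a : TotalSpace F V) : ℝ :=
  A.lieDeriv A.liouville L a - L a

/-- A smooth projectable section `a ↦ (a, σ(τ(a)), X(a))` of `𝒯ᴱE`. -/
structure ProjectableSection where
  base : Cₛ^∞⟮𝓡 n; F, V⟯
  field : ∀ a : TotalSpace F V, TangentSpace ((𝓡 n).prod 𝓘(ℝ, F)) a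
  contMDiff_field : ContMDiff ((𝓡 n).prod 𝓘(ℝ, F)) ((𝓡 n).prod 𝓘(ℝ, F)).tangent ∞
    (fun a => (⟨a, field a⟩ : TangentBundle ((𝓡 n).prod 𝓘(ℝ, F)) (TotalSpace F V)))
  anchor_base : ∀ a : TotalSpace F V, A.anchor a.1 (base a.1) =
    mfderiv ((𝓡 n).prod 𝓘(ℝ, F)) (𝓡 n) (TotalSpace.proj : TotalSpace F V → M) a (field a)

namespace ProjectableSection

variable {A}

/-- The value of a projectable section at a point. -/
noncomputable def value (Z : A.ProjectableSection) (a : TotalSpace F V) : A.prolongation a :=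
  ⟨(Z.base a.1, Z.field a), Z.anchor_base a⟩

/-- `X(f ∘ τ) = (ρ(σ) f) ∘ τ`. -/
theorem mvfderiv_comp_proj (Z : A.ProjectableSection) {f : M → ℝ}
    (hf : ContMDiff (𝓡 n) 𝓘(ℝ, ℝ) ∞ f) (a : TotalSpace F V) :
    mvfderiv ((𝓡 n).prod 𝓘(ℝ, F)) (fun a : TotalSpace F V => f a.1) a (Z.field a) =
      mvfderiv (𝓡 n) f a.1 (A.anchorField Z.base a.1) := by
  have h1 := (contMDiff_proj (E := V) (F := F) (IB := 𝓡 n) (n := ∞)).mdifferentiable (by simp) a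
  have h2 : MDifferentiableAt (𝓡 n) 𝓘(ℝ, ℝ) f a.1 := hf.mdifferentiable (by simp) a.1
  have h3 : mvfderiv ((𝓡 n).prod 𝓘(ℝ, F)) (fun a : TotalSpace F V => f a.1) a (Z.field a) =
    mvfderiv (𝓡 n) f a.1 (mfderiv ((𝓡 n).prod 𝓘(ℝ, F)) (𝓡 n)
      (TotalSpace.proj : TotalSpace F V → M) a (Z.field a)) :=
    congrArg (fun m => m (Z.field a)) (h2.hasMFDerivAt.comp a h1.hasMFDerivAt).mfderiv
  rw [h3, ← Z.anchor_base a]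
  rfl

/-- The Lie bracket `[Z₁, Z₂](a) = (a, [σ₁, σ₂](τ(a)), [X₁, X₂](a))` of projectable sections. -/
noncomputable def bracket [FiniteDimensional ℝ F] [T2Space M] (Z W : A.ProjectableSection) :
    A.ProjectableSection where
  base := A.bracket Z.base W.base
  field := VectorField.mlieBracket ((𝓡 n).prod 𝓘(ℝ, F)) Z.field W.field
  contMDiff_field := by
    intro a
    have : IsManifold ((𝓡 n).prod 𝓘(ℝ, F)) (((⊤ : ℕ∞) : WithTop ℕ∞) + 1) (TotalSpace F V) := by
      simpa using Bundle.TotalSpace.isManifold (n := ∞) F V (IB := 𝓡 n)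
    have : IsManifold ((𝓡 n).prod 𝓘(ℝ, F)) (minSmoothness ℝ 3) (TotalSpace F V) := by
      rw [minSmoothness_of_isRCLikeNormedField]
      exact IsManifold.of_le (n := ∞ + 1) ENat.LEInfty.out
    exact ContMDiffAt.mlieBracket_vectorField (m := ⊤) (n := ⊤) (Z.contMDiff_field a)
      (W.contMDiff_field a) (by simp)
  anchor_base a := by
    refine tangent_ext (J := 𝓡 n) fun f hf => ?_
    have hm := Bundle.TotalSpace.isManifold (n := ∞) F V (IB := 𝓡 n)
    have hfp : ContMDiff ((𝓡 n).prod 𝓘(ℝ, F)) 𝓘(ℝ, ℝ) ∞ (fun a : TotalSpace F V => f a.1) :=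
      hf.comp (contMDiff_proj V)
    have h1 := (contMDiff_proj (E := V) (F := F) (IB := 𝓡 n) (n := ∞)).mdifferentiable
      (by simp) a
    have h2 : MDifferentiableAt (𝓡 n) 𝓘(ℝ, ℝ) f a.1 := hf.mdifferentiable (by simp) a.1
    have h3 : ∀ v, mvfderiv ((𝓡 n).prod 𝓘(ℝ, F)) (fun a : TotalSpace F V => f a.1) a v =
        mvfderiv (𝓡 n) f a.1 (mfderiv ((𝓡 n).prod 𝓘(ℝ, F)) (𝓡 n)
          (TotalSpace.proj : TotalSpace F V → M) a v) := fun v =>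
      congrArg (fun m => m v) (h2.hasMFDerivAt.comp a h1.hasMFDerivAt).mfderiv
    rw [← h3, mvfderiv_mlieBracket hfp Z.contMDiff_field W.contMDiff_field]
    have hZ : (fun a => mvfderiv ((𝓡 n).prod 𝓘(ℝ, F)) (fun a : TotalSpace F V => f a.1) a
        (Z.field a)) = fun a => mvfderiv (𝓡 n) f a.1 (A.anchorField Z.base a.1) :=
      funext fun a => Z.mvfderiv_comp_proj hf a
    have hW : (fun a => mvfderiv ((𝓡 n).prod 𝓘(ℝ, F)) (fun a : TotalSpace F V => f a.1) a
        (W.field a)) = fun a => mvfderiv (𝓡 n) f a.1 (A.anchorField W.base a.1) :=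
      funext fun a => W.mvfderiv_comp_proj hf a
    rw [hZ, hW,
      Z.mvfderiv_comp_proj (contMDiff_mvfderiv hf (A.contMDiff_anchorField W.base)) a,
      W.mvfderiv_comp_proj (contMDiff_mvfderiv hf (A.contMDiff_anchorField Z.base)) a]
    exact A.anchor_bracket Z.base W.base hf a.1

end ProjectableSection

theorem contMDiffAt_prodField {U : Set M} (hU : IsOpen U) {E : ∀ x : M, V x}
    (hE : ContMDiffOn (𝓡 n) ((𝓡 n).prod 𝓘(ℝ, F)) ∞ (fun y => (⟨y, E y⟩ : TotalSpace F V)) U)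
    (c : F) (p : M × F) (hp : p.1 ∈ U) :
    ContMDiffAt ((𝓡 n).prod 𝓘(ℝ, F)) ((𝓡 n).prod 𝓘(ℝ, F)).tangent ∞
      (fun p : M × F => (⟨p, (A.anchor p.1 (E p.1), c)⟩ :
        TangentBundle ((𝓡 n).prod 𝓘(ℝ, F)) (M × F))) p := by
  have h1 : ContMDiffAt ((𝓡 n).prod 𝓘(ℝ, F)) (𝓡 n).tangent ∞
      (fun p : M × F => (⟨p.1, A.anchor p.1 (E p.1)⟩ : TangentBundle (𝓡 n) M)) p :=
    (A.contMDiff_anchor.contMDiffAt.comp p.1 (hE.contMDiffAt (hU.mem_nhds hp))).comp p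
      contMDiffAt_fst
  have h2' : ContMDiff 𝓘(ℝ, F) 𝓘(ℝ, F).tangent ∞
      (fun w : F => (⟨w, c⟩ : TangentBundle 𝓘(ℝ, F) F)) :=
    contMDiff_vectorSpace_iff_contDiff.mpr contDiff_const
  have h2 : ContMDiffAt ((𝓡 n).prod 𝓘(ℝ, F)) 𝓘(ℝ, F).tangent ∞
      (fun p : M × F => (⟨p.2, c⟩ : TangentBundle 𝓘(ℝ, F) F)) p :=
    h2'.contMDiffAt.comp p contMDiffAt_snd
  exact (contMDiff_equivTangentBundleProd_symm (I := 𝓡 n) (M := M) (I' := 𝓘(ℝ, F))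
    (M' := F) (n := ∞)).contMDiffAt.comp p (h1.prodMk h2)

/-- Every element of the prolongation is the value of a projectable section. -/
theorem exists_projectableSection [FiniteDimensional ℝ F] [T2Space M] (a : TotalSpace F V)
    (z : A.prolongation a) : ∃ Z : A.ProjectableSection, Z.value a = z := by
  obtain ⟨ψ, U, hU, hψU, hUe, hψ, hψx, hE, σ, hσx, hσ⟩ :=
    exists_section (n := n) (F := F) z.1.1
  set e := trivializationAt F V a.1 with he
  set E := FiberBundle.extend F z.1.1
  have hm := Bundle.TotalSpace.isManifold (n := ∞) F V (IB := 𝓡 n)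
  have hm' : IsManifold ((𝓡 n).prod 𝓘(ℝ, F)) ∞ (M × F) := inferInstance
  have hesm := e.contMDiffOn (IB := 𝓡 n) (n := ∞)
  have hed : e.toOpenPartialHomeomorph.MDifferentiable ((𝓡 n).prod 𝓘(ℝ, F))
      ((𝓡 n).prod 𝓘(ℝ, F)) :=
    ⟨hesm.mdifferentiableOn (by simp),
      (e.contMDiffOn_symm (IB := 𝓡 n) (n := ∞)).mdifferentiableOn (by simp)⟩
  have hinv : ∀ q : TotalSpace F V, q.1 ∈ e.baseSet →
      (mfderiv ((𝓡 n).prod 𝓘(ℝ, F)) ((𝓡 n).prod 𝓘(ℝ, F)) e q).IsInvertible := fun q hq =>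
    ⟨hed.mfderiv (e.mem_source.mpr hq), rfl⟩
  have hproj : ∀ q : TotalSpace F V, q.1 ∈ e.baseSet →
      ∀ v : TangentSpace ((𝓡 n).prod 𝓘(ℝ, F)) q,
      mfderiv ((𝓡 n).prod 𝓘(ℝ, F)) (𝓡 n) (TotalSpace.proj : TotalSpace F V → M) q v =
        (mfderiv ((𝓡 n).prod 𝓘(ℝ, F)) ((𝓡 n).prod 𝓘(ℝ, F)) e q v).1 := by
    intro q hq v
    have hq' := e.mem_source.mpr hq
    have h1 : (TotalSpace.proj : TotalSpace F V → M) =ᶠ[𝓝 q] Prod.fst ∘ e := by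
      filter_upwards [e.open_source.mem_nhds hq'] with y hy
      exact (e.coe_fst hy).symm
    rw [h1.mfderiv_eq]
    have h2 := hasMFDerivAt_fst (I := 𝓡 n) (I' := 𝓘(ℝ, F)) (M := M) (M' := F) (e q)
    have h3 := h2.comp q (hed.mdifferentiableAt hq').hasMFDerivAt
    exact congrArg (fun m => m v) h3.mfderiv
  let c : F := (mfderiv ((𝓡 n).prod 𝓘(ℝ, F)) ((𝓡 n).prod 𝓘(ℝ, F)) e a z.1.2).2
  let Y : ∀ p : M × F, TangentSpace ((𝓡 n).prod 𝓘(ℝ, F)) p := fun p => (A.anchor p.1 (E p.1), c)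
  let X : ∀ q : TotalSpace F V, TangentSpace ((𝓡 n).prod 𝓘(ℝ, F)) q := fun q =>
    ψ q.1 • VectorField.mpullback ((𝓡 n).prod 𝓘(ℝ, F)) ((𝓡 n).prod 𝓘(ℝ, F)) e Y q
  have hX : ContMDiff ((𝓡 n).prod 𝓘(ℝ, F)) ((𝓡 n).prod 𝓘(ℝ, F)).tangent ∞
      (fun q => (⟨q, X q⟩ : TangentBundle ((𝓡 n).prod 𝓘(ℝ, F)) (TotalSpace F V))) := by
    have hc : Continuous (TotalSpace.proj : TotalSpace F V → M) :=
      FiberBundle.continuous_proj F V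
    refine ContMDiffOn.smul_section_of_tsupport (u := TotalSpace.proj ⁻¹' U)
      (ψ := fun q : TotalSpace F V => ψ q.1)
      (hψ.comp (contMDiff_proj V)).contMDiffOn (hU.preimage hc) ?_ ?_
    · exact (tsupport_comp_subset_preimage ψ hc).trans (Set.preimage_mono hψU)
    · intro q hq
      refine ContMDiffAt.contMDiffWithinAt ?_
      have hq' := e.mem_source.mpr (hUe hq)
      refine ContMDiffAt.mpullback_vectorField_preimage (n := ∞) ?_ ?_ (hinv q (hUe hq)) (by simp)
      · exact A.contMDiffAt_prodField hU hE c (e q) (by rw [e.coe_fst hq']; exact hq)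
      · exact hesm.contMDiffAt (e.open_source.mem_nhds hq')
  have hDX : ∀ q : TotalSpace F V, q.1 ∈ e.baseSet →
      mfderiv ((𝓡 n).prod 𝓘(ℝ, F)) ((𝓡 n).prod 𝓘(ℝ, F)) e q
        (VectorField.mpullback ((𝓡 n).prod 𝓘(ℝ, F)) ((𝓡 n).prod 𝓘(ℝ, F)) e Y q) = Y (e q) := by
    intro q hq
    rw [VectorField.mpullback_apply]
    exact (hinv q hq).self_apply_inverse _
  let G : M → EuclideanSpace ℝ (Fin n) := fun x => A.anchor x (E x)
  have hG : ∀ q : TotalSpace F V, q.1 ∈ e.baseSet → G (e q).1 = G q.1 := fun q hq =>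
    congrArg G (e.coe_fst (e.mem_source.mpr hq))
  refine ⟨⟨σ, X, hX, ?_⟩, ?_⟩
  · intro q
    by_cases hq : q.1 ∈ U
    · rw [hσ, map_smul, map_smul, hproj q (hUe hq), hDX q (hUe hq)]
      exact congrArg (ψ q.1 • ·) (hG q (hUe hq)).symm
    · have h0 : ψ q.1 = 0 := image_eq_zero_of_notMem_tsupport fun h => hq (hψU h)
      rw [hσ, h0]
      simp [X, h0]
  · have ha : a.1 ∈ e.baseSet := FiberBundle.mem_baseSet_trivializationAt F V a.1
    refine Subtype.ext (Prod.ext hσx ?_)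
    apply hed.mfderiv_injective (e.mem_source.mpr ha)
    change mfderiv ((𝓡 n).prod 𝓘(ℝ, F)) ((𝓡 n).prod 𝓘(ℝ, F)) e a (X a) = _
    have h1 : X a =
        VectorField.mpullback ((𝓡 n).prod 𝓘(ℝ, F)) ((𝓡 n).prod 𝓘(ℝ, F)) e Y a := by
      simp only [X, hψx, one_smul]
    rw [h1, hDX a ha]
    refine Prod.ext ?_ rfl
    refine (hG a ha).trans ?_
    refine Eq.trans ?_ (hproj a ha z.1.2)
    refine Eq.trans ?_ z.2
    change A.anchor a.1 (E a.1) = _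
    rw [show E a.1 = z.1.1 from FiberBundle.extend_apply_self ..]

/-- The Lie algebroid exterior derivative of a one-form `θ` on `𝒯ᴱE`, evaluated on two projectable
sections: `dθ(Z, W) = ρ¹(Z)(θ(W)) - ρ¹(W)(θ(Z)) - θ([Z, W])`. -/
noncomputable def extDerivSections [FiniteDimensional ℝ F] [T2Space M]
    (θ : ∀ a : TotalSpace F V, A.prolongation a →ₗ[ℝ] ℝ) (Z W : A.ProjectableSection)
    (a : TotalSpace F V) : ℝ :=
  A.dFun (fun a => θ a (W.value a)) a (Z.value a) - A.dFun (fun a => θ a (Z.value a)) a (W.value a)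
    - θ a ((Z.bracket W).value a)

/-- A projectable section through a given element of `𝒯ᴱE`. -/
noncomputable def extendProjectable [FiniteDimensional ℝ F] [T2Space M] {a : TotalSpace F V}
    (z : A.prolongation a) : A.ProjectableSection :=
  (A.exists_projectableSection a z).choose

/-- The exterior derivative `dθ` of a one-form on `𝒯ᴱE` as a two-form. Since `dθ` is tensorial,
it is evaluated on `z` and `w` by extending them to projectable sections; the value
does not depend on the extensions (see `cartanTwoForm_value` for `ω_L`). -/
noncomputable def extDeriv [FiniteDimensional ℝ F] [T2Space M]
    (θ : ∀ a : TotalSpace F V, A.prolongation a →ₗ[ℝ] ℝ) (a : TotalSpace F V)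
    (z w : A.prolongation a) : ℝ :=
  A.extDerivSections θ (A.extendProjectable z) (A.extendProjectable w) a

/-- The Cartan two-form `ω_L = -dθ_L`. -/
noncomputable def cartanTwoForm [FiniteDimensional ℝ F] [T2Space M]
    (L : TotalSpace F V → ℝ) (a : TotalSpace F V) (z w : A.prolongation a) : ℝ :=
  -A.extDeriv (A.cartanOneForm L) a z w

end LieAlgebroid

namespace LieAlgebroid

variable (A : LieAlgebroid n F V)

theorem contMDiff_translate (σ : Cₛ^∞⟮𝓡 n; F, V⟯) :
    ContMDiff (((𝓡 n).prod 𝓘(ℝ, F)).prod 𝓘(ℝ, ℝ)) ((𝓡 n).prod 𝓘(ℝ, F)) ∞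
      (fun p : TotalSpace F V × ℝ => (⟨p.1.1, p.1.2 + p.2 • σ p.1.1⟩ : TotalSpace F V)) := by
  intro p
  have hfst : ContMDiffAt (((𝓡 n).prod 𝓘(ℝ, F)).prod 𝓘(ℝ, ℝ)) ((𝓡 n).prod 𝓘(ℝ, F)) ∞
      (fun p : TotalSpace F V × ℝ => p.1) p := contMDiffAt_fst
  have hpr : ContMDiffAt (((𝓡 n).prod 𝓘(ℝ, F)).prod 𝓘(ℝ, ℝ)) (𝓡 n) ∞
      (fun p : TotalSpace F V × ℝ => p.1.1) p := (contMDiffAt_totalSpace.mp hfst).1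
  have hσ : ContMDiffAt (((𝓡 n).prod 𝓘(ℝ, F)).prod 𝓘(ℝ, ℝ)) ((𝓡 n).prod 𝓘(ℝ, F)) ∞
      (fun p : TotalSpace F V × ℝ => (⟨p.1.1, σ p.1.1⟩ : TotalSpace F V)) p :=
    σ.contMDiff.contMDiffAt.comp p hpr
  refine contMDiffAt_totalSpace.mpr ⟨hpr, ?_⟩
  have h1 := (contMDiffAt_totalSpace.mp hfst).2
  have h2 := (contMDiffAt_totalSpace.mp hσ).2
  have h3 : ContMDiffAt (((𝓡 n).prod 𝓘(ℝ, F)).prod 𝓘(ℝ, ℝ)) 𝓘(ℝ, ℝ) ∞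
      (fun p : TotalSpace F V × ℝ => p.2) p := contMDiffAt_snd
  refine (h1.add (h3.smul h2)).congr_of_eventuallyEq ?_
  have hb := hpr.continuousAt.preimage_mem_nhds
    ((trivializationAt F V p.1.1).open_baseSet.mem_nhds
      (FiberBundle.mem_baseSet_trivializationAt F V p.1.1))
  filter_upwards [hb] with q hq
  have hl := (trivializationAt F V p.1.1).linear ℝ hq
  simp only [Pi.add_apply]
  refine (hl.map_add _ _).trans ?_
  exact congrArg _ (hl.map_smul _ _)

/-- `θ_L` evaluated on a section `σ` of `E`, as a function on `E`. -/
noncomputable def fibreDeriv (L : TotalSpace F V → ℝ) (σ : Cₛ^∞⟮𝓡 n; F, V⟯)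
    (a : TotalSpace F V) : ℝ :=
  mvfderiv ((𝓡 n).prod 𝓘(ℝ, F)) L a (verticalVector a (σ a.1))

theorem contMDiff_fibreDeriv [FiniteDimensional ℝ F] {L : TotalSpace F V → ℝ}
    (hL : ContMDiff ((𝓡 n).prod 𝓘(ℝ, F)) 𝓘(ℝ, ℝ) ∞ L) (σ : Cₛ^∞⟮𝓡 n; F, V⟯) :
    ContMDiff ((𝓡 n).prod 𝓘(ℝ, F)) 𝓘(ℝ, ℝ) ∞ (fibreDeriv (n := n) L σ) := by
  have hm := Bundle.TotalSpace.isManifold (n := ∞) F V (IB := 𝓡 n)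
  have hΦ := contMDiff_translate (n := n) σ
  have hLΦ := hL.comp hΦ
  have hX : ContMDiff (((𝓡 n).prod 𝓘(ℝ, F)).prod 𝓘(ℝ, ℝ))
      (((𝓡 n).prod 𝓘(ℝ, F)).prod 𝓘(ℝ, ℝ)).tangent ∞
      (fun p : TotalSpace F V × ℝ => (⟨p, (0, (1 : ℝ))⟩ :
        TangentBundle (((𝓡 n).prod 𝓘(ℝ, F)).prod 𝓘(ℝ, ℝ)) (TotalSpace F V × ℝ))) := by
    have h1 : ContMDiff ((𝓡 n).prod 𝓘(ℝ, F)) ((𝓡 n).prod 𝓘(ℝ, F)).tangent ∞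
        (fun a : TotalSpace F V => (⟨a, 0⟩ :
          TangentBundle ((𝓡 n).prod 𝓘(ℝ, F)) (TotalSpace F V))) :=
      contMDiff_zeroSection _ _
    have h2 : ContMDiff 𝓘(ℝ, ℝ) 𝓘(ℝ, ℝ).tangent ∞
        (fun w : ℝ => (⟨w, (1 : ℝ)⟩ : TangentBundle 𝓘(ℝ, ℝ) ℝ)) :=
      contMDiff_vectorSpace_iff_contDiff.mpr contDiff_const
    exact (contMDiff_equivTangentBundleProd_symm (I := (𝓡 n).prod 𝓘(ℝ, F))
      (M := TotalSpace F V) (I' := 𝓘(ℝ, ℝ)) (M' := ℝ) (n := ∞)).comp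
      ((h1.comp contMDiff_fst).prodMk (h2.comp contMDiff_snd))
  have h := (contMDiff_mvfderiv hLΦ hX).comp
    (contMDiff_id.prodMk contMDiff_const : ContMDiff ((𝓡 n).prod 𝓘(ℝ, F))
      (((𝓡 n).prod 𝓘(ℝ, F)).prod 𝓘(ℝ, ℝ)) ∞ (fun a : TotalSpace F V => (a, (0 : ℝ))))
  refine h.congr fun a => ?_
  have hmd := (hLΦ.mdifferentiable (by simp) (a, (0 : ℝ))).hasMFDerivAt
  have hin : HasMFDerivAt 𝓘(ℝ, ℝ) (((𝓡 n).prod 𝓘(ℝ, F)).prod 𝓘(ℝ, ℝ))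
      (fun t : ℝ => (a, t)) 0 (ContinuousLinearMap.inr ℝ _ ℝ) := 
    (hasMFDerivAt_const a (0:ℝ)).prodMk (hasMFDerivAt_id (0:ℝ))
  have h1 := hmd.comp (0 : ℝ) hin
  obtain ⟨T, hT⟩ := hasMFDerivAt_line (n := n) a
  have h2 := HasMFDerivAt.comp (0 : ℝ) (hL.mdifferentiable (by simp) 
    (⟨a.1, a.2 + (0 : ℝ) • σ a.1⟩ : TotalSpace F V)).hasMFDerivAt (hT (σ a.1)).1.hasMFDerivAt
  have h3 := congrArg (fun m => m (1 : ℝ)) (hasMFDerivAt_unique h1 h2)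
  refine Eq.trans ?_ h3.symm
  let G : TotalSpace F V → (EuclideanSpace ℝ (Fin n) × F →L[ℝ] ℝ) :=
    fun a => mfderiv ((𝓡 n).prod 𝓘(ℝ, F)) 𝓘(ℝ, ℝ) L a
  have h0 : (⟨a.1, a.2 + (0 : ℝ) • σ a.1⟩ : TotalSpace F V) = a := by simp
  change G a _ = G ⟨a.1, a.2 + (0 : ℝ) • σ a.1⟩ _
  rw [h0]
  rfl

theorem cartanOneForm_value (L : TotalSpace F V → ℝ) (Z : A.ProjectableSection)
    (a : TotalSpace F V) :
    A.cartanOneForm L a (Z.value a) = fibreDeriv (n := n) L Z.base a := rfl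

/-- The part of `dθ_L(Z, W)` that involves the derivatives of `Z`. -/
noncomputable def tensorPart (L : TotalSpace F V → ℝ) (W : A.ProjectableSection)
    (a : TotalSpace F V) (σ : Cₛ^∞⟮𝓡 n; F, V⟯) : ℝ :=
  mvfderiv ((𝓡 n).prod 𝓘(ℝ, F)) (fibreDeriv (n := n) L σ) a (W.field a) -
    fibreDeriv (n := n) L (A.bracket W.base σ) a

theorem fibreDeriv_add (L : TotalSpace F V → ℝ) (σ η : Cₛ^∞⟮𝓡 n; F, V⟯) :
    fibreDeriv (n := n) L (σ + η) = fibreDeriv L σ + fibreDeriv L η := by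
  funext a
  simp only [fibreDeriv, ContMDiffSection.coe_add, Pi.add_apply, map_add]

theorem fibreDeriv_smul (L : TotalSpace F V → ℝ) (f : C^∞⟮𝓡 n, M; 𝓘(ℝ, ℝ), ℝ⟯)
    (σ : Cₛ^∞⟮𝓡 n; F, V⟯) :
    fibreDeriv (n := n) L (smulSection f σ) = (fun a => f a.1) * fibreDeriv L σ := by
  funext a
  change mvfderiv ((𝓡 n).prod 𝓘(ℝ, F)) L a (verticalVector a (f a.1 • σ a.1)) = _
  rw [map_smul, map_smul]
  rfl

theorem tensorPart_add [FiniteDimensional ℝ F] {L : TotalSpace F V → ℝ}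
    (hL : ContMDiff ((𝓡 n).prod 𝓘(ℝ, F)) 𝓘(ℝ, ℝ) ∞ L) (W : A.ProjectableSection)
    (a : TotalSpace F V) (σ η : Cₛ^∞⟮𝓡 n; F, V⟯) :
    A.tensorPart L W a (σ + η) = A.tensorPart L W a σ + A.tensorPart L W a η := by
  have h := fun σ => (contMDiff_fibreDeriv hL σ).mdifferentiable (by simp) a
  simp only [tensorPart, fibreDeriv_add, map_add]
  rw [mvfderiv_add (h σ) (h η)]
  simp only [_root_.add_apply, Pi.add_apply]
  ring

theorem tensorPart_smul [FiniteDimensional ℝ F] {L : TotalSpace F V → ℝ}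
    (hL : ContMDiff ((𝓡 n).prod 𝓘(ℝ, F)) 𝓘(ℝ, ℝ) ∞ L) (W : A.ProjectableSection)
    (a : TotalSpace F V) (f : C^∞⟮𝓡 n, M; 𝓘(ℝ, ℝ), ℝ⟯) (σ : Cₛ^∞⟮𝓡 n; F, V⟯) :
    A.tensorPart L W a (smulSection f σ) = f a.1 * A.tensorPart L W a σ := by
  have h := (contMDiff_fibreDeriv hL σ).mdifferentiable (by simp) a
  have hf : ContMDiff ((𝓡 n).prod 𝓘(ℝ, F)) 𝓘(ℝ, ℝ) ∞ (fun a : TotalSpace F V => f a.1) :=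
    f.contMDiff.comp (contMDiff_proj V)
  have hbr : fibreDeriv (n := n) L (A.bracket W.base (smulSection f σ)) a =
      f a.1 * fibreDeriv L (A.bracket W.base σ) a +
        mvfderiv (𝓡 n) f a.1 (A.anchorField W.base a.1) * fibreDeriv L σ a := by
    simp only [fibreDeriv]
    rw [A.leibniz, map_add, map_smul, map_smul, map_add, map_smul, map_smul]
    rfl
  simp only [tensorPart]
  rw [hbr, fibreDeriv_smul, mvfderiv_mul (hf.mdifferentiable (by simp) a) h]
  have := W.mvfderiv_comp_proj f.contMDiff a
  simp only [_root_.add_apply, _root_.smul_apply, this, smul_eq_mul]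
  ring

theorem tensorPart_eq_zero [FiniteDimensional ℝ F] [T2Space M] {L : TotalSpace F V → ℝ}
    (hL : ContMDiff ((𝓡 n).prod 𝓘(ℝ, F)) 𝓘(ℝ, ℝ) ∞ L) (W : A.ProjectableSection)
    (a : TotalSpace F V) (σ : Cₛ^∞⟮𝓡 n; F, V⟯) (hσ : σ a.1 = 0) : A.tensorPart L W a σ = 0 := by
  have : IsManifold (𝓡 n) 1 M := IsManifold.of_le (n := ∞) (by simp)
  have : ContMDiffVectorBundle 1 F V (𝓡 n) := ContMDiffVectorBundle.of_le (n := ∞) (by simp)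
  let e := trivializationAt F V a.1
  have hx : a.1 ∈ e.baseSet := FiberBundle.mem_baseSet_trivializationAt F V a.1
  let b := Module.finBasis ℝ F
  obtain ⟨ψ, h1, h2, h3⟩ := exists_bump (J := 𝓡 n) a.1 (e.open_baseSet.mem_nhds hx)
  have h4 : ψ a.1 = 1 := h3.self_of_nhds
  let g : C^∞⟮𝓡 n, M; 𝓘(ℝ, ℝ), ℝ⟯ := ⟨ψ, h1⟩
  let s : Fin (Module.finrank ℝ F) → Cₛ^∞⟮𝓡 n; F, V⟯ := fun i => ⟨ψ • e.localFrame b i,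
    ContMDiffOn.smul_section_of_tsupport h1.contMDiffOn e.open_baseSet h2
      (e.contMDiffOn_localFrame_baseSet ∞ b i)⟩
  let f : Fin (Module.finrank ℝ F) → C^∞⟮𝓡 n, M; 𝓘(ℝ, ℝ), ℝ⟯ := fun i =>
    ⟨fun x => ψ x • e.localFrameCoeff (𝓡 n) b i x (σ x), by
      refine contMDiff_of_tsupport fun x hx => ?_
      have hxe : x ∈ e.baseSet := h2 (closure_mono (Function.support_smul_subset_left _ _) hx)
      exact (h1 x).smul (contMDiffAt_localFrameCoeff b hxe (σ.contMDiff x) i)⟩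
  have hsum : smulSection g (smulSection g σ) = ∑ i, smulSection (f i) (s i) := by
    ext x
    have hc : (∑ i, smulSection (f i) (s i)) x = ∑ i, smulSection (f i) (s i) x := by
      have := map_sum (ContMDiffSection.coeAddHom (𝓡 n) F ∞ V) (fun i => smulSection (f i) (s i))
        Finset.univ
      exact (congrFun this x).trans (Finset.sum_apply _ _ _)
    rw [hc]
    change ψ x • ψ x • σ x =
      ∑ i, (ψ x • e.localFrameCoeff (𝓡 n) b i x (σ x)) • ψ x • e.localFrame b i x
    by_cases hxe : x ∈ e.baseSet
    · conv_lhs => rw [e.eq_sum_localFrameCoeff_smul (I := 𝓡 n) (b := b) (s := σ) hxe]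
      rw [Finset.smul_sum, Finset.smul_sum]
      refine Finset.sum_congr rfl fun i _ => ?_
      simp only [smul_smul, smul_eq_mul]
      congr 1
      ring
    · have : ψ x = 0 := image_eq_zero_of_notMem_tsupport fun h => hxe (h2 h)
      simp [this]
  have h5 : A.tensorPart L W a (smulSection g (smulSection g σ)) = A.tensorPart L W a σ := by
    rw [A.tensorPart_smul hL, A.tensorPart_smul hL]
    change ψ a.1 * (ψ a.1 * _) = _
    rw [h4, one_mul, one_mul]
  let Q : Cₛ^∞⟮𝓡 n; F, V⟯ →+ ℝ := AddMonoidHom.mk' (A.tensorPart L W a) (A.tensorPart_add hL W a)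
  rw [← h5, hsum]
  change Q _ = 0
  rw [map_sum]
  refine Finset.sum_eq_zero fun i _ => ?_
  change A.tensorPart L W a _ = 0
  rw [A.tensorPart_smul hL]
  change (ψ a.1 • e.localFrameCoeff (𝓡 n) b i a.1 (σ a.1)) * _ = 0
  rw [hσ]
  simp

theorem extDerivSections_eq [FiniteDimensional ℝ F] [T2Space M] (L : TotalSpace F V → ℝ)
    (Z W : A.ProjectableSection) (a : TotalSpace F V) :
    A.extDerivSections (A.cartanOneForm L) Z W a =
      mvfderiv ((𝓡 n).prod 𝓘(ℝ, F)) (fibreDeriv (n := n) L W.base) a (Z.field a) -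
        A.tensorPart L W a Z.base := by
  have hsw : A.bracket Z.base W.base = -A.bracket W.base Z.base := by
    have h := A.bracket_self (Z.base + W.base)
    simp only [map_add, LinearMap.add_apply, A.bracket_self, zero_add, add_zero] at h
    exact eq_neg_of_add_eq_zero_right h
  have h1 : A.cartanOneForm L a ((Z.bracket W).value a) =
      -fibreDeriv (n := n) L (A.bracket W.base Z.base) a := by
    rw [cartanOneForm_value]
    change fibreDeriv (n := n) L (A.bracket Z.base W.base) a = _
    rw [hsw]
    simp only [fibreDeriv, ContMDiffSection.coe_neg, Pi.neg_apply, map_neg]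
  rw [extDerivSections, h1, tensorPart]
  change mvfderiv ((𝓡 n).prod 𝓘(ℝ, F)) (fibreDeriv (n := n) L W.base) a (Z.field a) - mvfderiv ((𝓡 n).prod 𝓘(ℝ, F)) (fibreDeriv (n := n) L Z.base) a (W.field a) - _ = _
  ring

theorem extDerivSections_swap [FiniteDimensional ℝ F] [T2Space M] (L : TotalSpace F V → ℝ)
    (Z W : A.ProjectableSection) (a : TotalSpace F V) :
    A.extDerivSections (A.cartanOneForm L) Z W a =
      -A.extDerivSections (A.cartanOneForm L) W Z a := by
  rw [extDerivSections_eq, extDerivSections, tensorPart]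
  change _ = -(mvfderiv ((𝓡 n).prod 𝓘(ℝ, F)) (fibreDeriv (n := n) L Z.base) a (W.field a) -
    mvfderiv ((𝓡 n).prod 𝓘(ℝ, F)) (fibreDeriv (n := n) L W.base) a (Z.field a) -
    fibreDeriv (n := n) L (A.bracket W.base Z.base) a)
  ring

theorem extDerivSections_congr_left [FiniteDimensional ℝ F] [T2Space M] {L : TotalSpace F V → ℝ}
    (hL : ContMDiff ((𝓡 n).prod 𝓘(ℝ, F)) 𝓘(ℝ, ℝ) ∞ L) {Z Z' : A.ProjectableSection}
    (W : A.ProjectableSection) {a : TotalSpace F V} (h : Z.value a = Z'.value a) :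
    A.extDerivSections (A.cartanOneForm L) Z W a =
      A.extDerivSections (A.cartanOneForm L) Z' W a := by
  have h1 : Z.base a.1 = Z'.base a.1 := congrArg (fun z => z.1.1) h
  have h2 : Z.field a = Z'.field a := congrArg (fun z => z.1.2) h
  have h3 := A.tensorPart_add hL W a (Z.base - Z'.base) Z'.base
  rw [sub_add_cancel, A.tensorPart_eq_zero hL W a (Z.base - Z'.base)
    (by rw [ContMDiffSection.coe_sub, Pi.sub_apply, h1, sub_self]), zero_add] at h3
  rw [extDerivSections_eq, extDerivSections_eq, h2, h3]

/-- `ω_L` may be computed with arbitrary projectable sections through the two arguments. -/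
theorem cartanTwoForm_value [FiniteDimensional ℝ F] [T2Space M] {L : TotalSpace F V → ℝ}
    (hL : ContMDiff ((𝓡 n).prod 𝓘(ℝ, F)) 𝓘(ℝ, ℝ) ∞ L) (Z W : A.ProjectableSection)
    (a : TotalSpace F V) :
    A.cartanTwoForm L a (Z.value a) (W.value a) =
      -A.extDerivSections (A.cartanOneForm L) Z W a := by
  have hz : ∀ z : A.prolongation a, (A.extendProjectable z).value a = z :=
    fun z => (A.exists_projectableSection a z).choose_spec
  rw [cartanTwoForm, extDeriv, A.extDerivSections_congr_left hL _ (hz _),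
    A.extDerivSections_swap, A.extDerivSections_congr_left hL _ (hz _),
    ← A.extDerivSections_swap]

end LieAlgebroid

/-- A smooth vector subbundle of `V`: a family of subspaces of the fibres that is locally spanned
by smooth, pointwise linearly independent sections. -/
def IsSmoothSubbundle (D : ∀ x : M, Submodule ℝ (V x)) : Prop :=
  ∀ x₀ : M, ∃ U : Set M, IsOpen U ∧ x₀ ∈ U ∧ ∃ (k : ℕ) (s : Fin k → ∀ x : M, V x),
    (∀ i, ContMDiffOn (𝓡 n) ((𝓡 n).prod 𝓘(ℝ, F)) ∞
      (fun x => (⟨x, s i x⟩ : TotalSpace F V)) U) ∧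
    ∀ x ∈ U, LinearIndependent ℝ (fun i => s i x) ∧
      Submodule.span ℝ (Set.range fun i => s i x) = D x

/-- `v ∈ T_aE` is tangent to the subset `N` of `E`: it is the velocity at time `0` of a smooth
curve in `N`. -/
def IsTangentTo (N : Set (TotalSpace F V)) (a : TotalSpace F V)
    (v : TangentSpace ((𝓡 n).prod 𝓘(ℝ, F)) a) : Prop :=
  ∃ γ : ℝ → TotalSpace F V, ContMDiff 𝓘(ℝ, ℝ) ((𝓡 n).prod 𝓘(ℝ, F)) ∞ γ ∧ (∀ t, γ t ∈ N) ∧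
    tangentMap 𝓘(ℝ, ℝ) ((𝓡 n).prod 𝓘(ℝ, F)) γ ⟨0, (1 : ℝ)⟩ = ⟨a, v⟩

/-- A nonholonomically constrained Lagrangian system `(L, D)` on a Lie algebroid. -/
structure ConstrainedLagrangianSystem (A : LieAlgebroid n F V) where
  lagrangian : TotalSpace F V → ℝ
  contMDiff_lagrangian : ContMDiff ((𝓡 n).prod 𝓘(ℝ, F)) 𝓘(ℝ, ℝ) ∞ lagrangian
  constraint : ∀ x : M, Submodule ℝ (V x)
  isSmoothSubbundle_constraint : IsSmoothSubbundle (n := n) (F := F) constraint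

namespace ConstrainedLagrangianSystem

variable {A : LieAlgebroid n F V} (S : ConstrainedLagrangianSystem A)

/-- The constraint subbundle `D` as a subset of the total space of `E`. -/
def constraintSet : Set (TotalSpace F V) :=
  {a | a.2 ∈ S.constraint a.1}

/-- The fibre condition for `𝒯ᴰD ⊆ 𝒯ᴱE` at a point `a ∈ D`: `(b, v)` with `b ∈ D` and `v` tangent
to `D`. -/
def MemProlongation {a : TotalSpace F V} (z : A.prolongation a) : Prop :=
  A.prolProj a z ∈ S.constraint a.1 ∧ IsTangentTo S.constraintSet a (A.prolAnchor a z)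

/-- `Γ` is a solution of the constrained Lagrangian system `(L, D)`: a smooth SODE section
(`SΓ = Δ`) satisfying the Lagrange-d'Alembert equations
`(i_Γ ω_L - dE_L)|_D ∈ Sec(D̃°)` and `Γ|_D ∈ Sec(𝒯ᴰD)`.
A solution only needs to be given along `D`, so the values of `Γ` outside `D` are irrelevant and
nothing is required of them. -/
structure IsSolution [FiniteDimensional ℝ F] [T2Space M]
    (Γ : ∀ a : TotalSpace F V, A.prolongation a) : Prop where
  contMDiffOn_proj : ContMDiffOn ((𝓡 n).prod 𝓘(ℝ, F)) ((𝓡 n).prod 𝓘(ℝ, F)) ∞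
    (fun a => (⟨a.1, A.prolProj a (Γ a)⟩ : TotalSpace F V)) S.constraintSet
  contMDiffOn_anchor : ContMDiffOn ((𝓡 n).prod 𝓘(ℝ, F)) ((𝓡 n).prod 𝓘(ℝ, F)).tangent ∞
    (fun a => (⟨a, A.prolAnchor a (Γ a)⟩ :
      TangentBundle ((𝓡 n).prod 𝓘(ℝ, F)) (TotalSpace F V))) S.constraintSet
  sode : ∀ a ∈ S.constraintSet, A.verticalEndo a (Γ a) = A.liouville a
  force : ∀ a ∈ S.constraintSet, ∃ μ : V a.1 →ₗ[ℝ] ℝ, (∀ b ∈ S.constraint a.1, μ b = 0) ∧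
    ∀ w : A.prolongation a, A.cartanTwoForm S.lagrangian a (Γ a) w -
      A.dFun (A.energy S.lagrangian) a w = μ (A.prolProj a w)
  mem : ∀ a ∈ S.constraintSet, S.MemProlongation (Γ a)

end ConstrainedLagrangianSystem

end Algebroid

/-! Energy is conserved because the constraint forces do no work along the motion. At a point `a` of
`D` the Lagrange–d'Alembert equation says that `ω_L(Γ, w) - dE_L(w) = μ(𝒯τ w)` for all `w` in the
fibre of the prolongation, with `μ` annihilating `D`. Contract it with `w = Γ(a)`. The term `ω_L(Γ,
Γ)` vanishes because `ω_L` is alternating. The force term vanishes because `Γ(a)` lies in the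
prolongation of `D`, so that its projection `𝒯τ(Γ(a))` lies in `D`, where `μ` is zero. What remains
is `-dE_L(Γ) = 0`. The contraction is pointwise: `Γ` is never differentiated, and only its value at
the given point enters. The one fact about `ω_L` is its skew-symmetry, which comes from
`extDerivSections_swap`. There, `θ_L` sees a section of the prolongation only through its component
in `E`, so the skew-symmetry of `dθ_L` reduces to that of the bracket of sections of `E`. -/

namespace LieAlgebroid

variable {n : ℕ} {M : Type*} [TopologicalSpace M] [T2Space M]
  [ChartedSpace (EuclideanSpace ℝ (Fin n)) M] [IsManifold (𝓡 n) ∞ M]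
  {F : Type*} [NormedAddCommGroup F] [NormedSpace ℝ F] [FiniteDimensional ℝ F]
  {V : M → Type*} [TopologicalSpace (TotalSpace F V)]
  [∀ x, AddCommGroup (V x)] [∀ x, Module ℝ (V x)] [∀ x, TopologicalSpace (V x)]
  [FiberBundle F V] [VectorBundle ℝ F V] [ContMDiffVectorBundle ∞ F V (𝓡 n)]

/-- The Cartan two-form is alternating. -/
theorem cartanTwoForm_self (A : LieAlgebroid n F V) (L : TotalSpace F V → ℝ)
    (a : TotalSpace F V) (z : A.prolongation a) : A.cartanTwoForm L a z z = 0 := by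
  -- The extension chosen by `extendProjectable` depends only on the element `z`, so both slots of
  -- `ω_L(z, z)` receive the same projectable section. Swapping them therefore gives a real number
  -- equal to its own negative, and independence of the choice of extension plays no role.
  have h := A.extDerivSections_swap L (A.extendProjectable z) (A.extendProjectable z) a
  rw [cartanTwoForm, extDeriv, self_eq_neg.mp h, neg_zero]

end LieAlgebroid

theorem mainTheorem9 {n : ℕ} {M : Type*} [TopologicalSpace M] [T2Space M]
    [ChartedSpace (EuclideanSpace ℝ (Fin n)) M] [IsManifold (𝓡 n) ∞ M]
    {F : Type*} [NormedAddCommGroup F] [NormedSpace ℝ F] [FiniteDimensional ℝ F]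
    {V : M → Type*} [TopologicalSpace (TotalSpace F V)]
    [∀ x, AddCommGroup (V x)] [∀ x, Module ℝ (V x)] [∀ x, TopologicalSpace (V x)]
    [FiberBundle F V] [VectorBundle ℝ F V] [ContMDiffVectorBundle ∞ F V (𝓡 n)]
    (A : LieAlgebroid n F V) (S : ConstrainedLagrangianSystem A)
    (Γ : ∀ a : TotalSpace F V, A.prolongation a) (hΓ : S.IsSolution Γ) :
    ∀ a ∈ S.constraintSet, A.lieDeriv Γ (A.energy S.lagrangian) a = 0 := by
  intro a ha
  obtain ⟨μ, hμ, h⟩ := hΓ.force a ha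
  -- The equation holds against every `w` in the fibre of the prolongation over `a`, hence against
  -- `Γ a` itself.
  have hforce := h (Γ a)
  -- The first half of `mem` places the projection of `Γ a` in the constraint fibre, and this is
  -- where the force covector `μ` vanishes. The left side is then `0 - dE_L(Γ a)`.
  rw [A.cartanTwoForm_self, hμ _ (hΓ.mem a ha).1, zero_sub] at hforce
  exact neg_eq_zero.mp hforce
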